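/- For a finite simple graph $G$ let $\mathrm{Ind}(G)$ be its independence complex: the simplicial complex on the vertex set of $G$ whose simplices are the independent sets of $G$, regarded as a topological space via its geometric realization. For a vertex $v$ let $N[v]$ be its closed neighbourhood ($v$ together with its neighbours), and for an edge $e=(u,v)$ let $N[e]=N[u]\cup N[v]$. Write $G\setminus N[e]$ for the subgraph of $G$ induced by the vertices outside $N[e]$, $e\sqcup(G\setminus N[e])$ for the subgraph of $G$ induced by $u$, $v$ and the vertices outside $N[e]$, $G-e$ for $G$ with the edge $e$ deleted, $G[x,y,u,v]$ for the subgraph induced by $\{x,y,u,v\}$, and $\Sigma$ for the unreduced suspension (so $\Sigma\emptyset=S^0$). **Theorem.** Let $e=(u,v)$ be an edge of a finite simple graph $G$. Suppose there are vertices $x,y\in N[e]$ such that $N[x]\cup N[y]\subseteq N[e]$ and the induced subgraph $G[x,y,u,v]$ is isomorphic to the $4$-vertex path $P_4$. Then the inclusion $\mathrm{Ind}(e\sqcup(G\setminus N[e]))\hookrightarrow\mathrm{Ind}(G)$ is null-homotopic. Consequently, there is a homotopy equivalence $$\mathrm{Ind}(G-e)\simeq\mathrm{Ind}(G)\vee\Sigma^2\,\mathrm{Ind}(G\setminus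 N[e]),$$ where the base point of $\mathrm{Ind}(G)$ is any point in the path component of the vertex $u$ (so any point at all if $\mathrm{Ind}(G)$ is connected), and the base point of $\Sigma^2\,\mathrm{Ind}(G\setminus N[e])$ is a pole of the suspension. -/

import Mathlib

/-- The geometric realization of an abstract simplicial complex `K`, in barycentric coordinates: the
points are the functions `p ≥ 0` on the vertices that are supported on a face of `K` and sum to `1`.
The topology is that of a subspace of `V → ℝ`, which is the usual one for a finite vertex set `V`
(the only case in which it is used). -/
def AbstractSimplicialComplex.Realization {V : Type*} (K : AbstractSimplicialComplex V) : Type _ :=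
  {p : V → ℝ // (∀ v, 0 ≤ p v) ∧ ∃ s ∈ K.faces, (∀ v, v ∉ s → p v = 0) ∧ ∑ v ∈ s, p v = 1}

instance AbstractSimplicialComplex.Realization.instTopologicalSpace {V : Type*}
    (K : AbstractSimplicialComplex V) : TopologicalSpace K.Realization :=
  inferInstanceAs (TopologicalSpace {p : V → ℝ // (∀ v, 0 ≤ p v) ∧
    ∃ s ∈ K.faces, (∀ v, v ∉ s → p v = 0) ∧ ∑ v ∈ s, p v = 1})

open Classical in
/-- The vertex `v` of `K` as a point of the geometric realization. -/
noncomputable def AbstractSimplicialComplex.vertex {V : Type*} (K : AbstractSimplicialComplex V)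
    (v : V) : K.Realization :=
  ⟨fun w => if w = v then 1 else 0, fun w => by positivity, {v}, K.singleton_mem v,
    fun w hw => if_neg (by simpa using hw), by simp⟩

namespace SimpleGraph

/-- The independence complex `Ind(G)`: its simplices are the nonempty independent sets of `G`. -/
def indComplex {V : Type*} (G : SimpleGraph V) : AbstractSimplicialComplex V where
  faces := {s | s.Nonempty ∧ G.IsIndepSet (s : Set V)}
  isRelLowerSet_faces := fun {_} hs =>
    ⟨hs.1, fun _ hts ht => ⟨ht, hs.2.mono (Finset.coe_subset.2 hts)⟩⟩
  singleton_mem v := ⟨Finset.singleton_nonempty v, by simp [IsIndepSet]⟩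

/-- `Ind(G)` as a topological space. -/
abbrev Ind {V : Type*} (G : SimpleGraph V) : Type _ := G.indComplex.Realization

/-- The inclusion `Ind(G[W]) ↪ Ind(G)` for a set `W` of vertices: barycentric coordinates are
extended by zero outside `W`. -/
noncomputable def indInclusion {V : Type*} (G : SimpleGraph V) (W : Set V) :
    C((G.induce W).Ind, G.Ind) where
  toFun p := ⟨Function.extend Subtype.val p.1 0, by
    obtain ⟨p, hp, s, ⟨hs, hi⟩, h0, h1⟩ := p
    have hW : ∀ w : W, Function.extend Subtype.val p 0 (w : V) = p w := fun w =>
      Subtype.val_injective.extend_apply p 0 w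
    refine ⟨fun v => ?_, s.map (Function.Embedding.subtype _), ⟨by simpa using hs, ?_⟩,
      fun v hv => ?_, ?_⟩
    · by_cases h : ∃ w : W, (w : V) = v
      · obtain ⟨w, rfl⟩ := h
        simpa only [hW] using hp w
      · simp [Function.extend_apply' _ _ _ h]
    · intro a ha b hb hab
      simp only [Finset.coe_map, Set.mem_image, Function.Embedding.subtype_apply] at ha hb
      obtain ⟨a, ha, rfl⟩ := ha
      obtain ⟨b, hb, rfl⟩ := hb
      exact hi ha hb (fun h => hab (congrArg _ h))
    · by_cases h : ∃ w : W, (w : V) = v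
      · obtain ⟨w, rfl⟩ := h
        simp only [hW]
        exact h0 w (fun hw => hv (Finset.mem_map_of_mem _ hw))
      · simp [Function.extend_apply' _ _ _ h]
    · simpa [Finset.sum_map, hW] using h1⟩
  continuous_toFun := by
    refine Continuous.subtype_mk (continuous_pi fun v => ?_) _
    by_cases h : ∃ w : W, (w : V) = v
    · obtain ⟨w, rfl⟩ := h
      simp only [Subtype.val_injective.extend_apply]
      exact (continuous_apply w).comp continuous_subtype_val
    · simp only [Function.extend_apply' _ _ _ h]
      exact continuous_const

/-- The closed neighbourhood `N[v]`. -/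
def closedNbhd {V : Type*} (G : SimpleGraph V) (v : V) : Set V := insert v (G.neighborSet v)

/-- The closed neighbourhood `N[e] = N[u] ∪ N[v]` of an edge `e = (u,v)`. -/
def edgeNbhd {V : Type*} (G : SimpleGraph V) (u v : V) : Set V := G.closedNbhd u ∪ G.closedNbhd v

end SimpleGraph

/-- The identifications in the unreduced suspension: `A × {0}` and `A × {1}` are each collapsed to
a pole. -/
inductive SuspensionRel (A : Type*) : (A × unitInterval) ⊕ Bool → (A × unitInterval) ⊕ Bool → Prop
  | zero (a : A) : SuspensionRel A (Sum.inl (a, 0)) (Sum.inr false)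
  | one (a : A) : SuspensionRel A (Sum.inl (a, 1)) (Sum.inr true)

/-- The unreduced suspension `Σ A`. The two poles are present also if `A` is empty, so that
`Σ ∅ = S⁰`. -/
def Suspension (A : Type*) : Type _ := Quot (SuspensionRel A)

instance Suspension.instTopologicalSpace (A : Type*) [TopologicalSpace A] :
    TopologicalSpace (Suspension A) :=
  inferInstanceAs (TopologicalSpace (Quot (SuspensionRel A)))

/-- The pole `A × {1}` of the suspension. -/
def Suspension.pole (A : Type*) : Suspension A := Quot.mk _ (Sum.inr true)

/-- The identification in the wedge sum. -/
inductive WedgeRel {X Y : Type*} (x : X) (y : Y) : X ⊕ Y → X ⊕ Y → Prop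
  | glue : WedgeRel x y (Sum.inl x) (Sum.inr y)

/-- The wedge sum `X ∨ Y` at the base points `x` and `y`: the disjoint union with `x` and `y`
identified. -/
def Wedge {X Y : Type*} (x : X) (y : Y) : Type _ := Quot (WedgeRel x y)

instance Wedge.instTopologicalSpace {X Y : Type*} [TopologicalSpace X] [TopologicalSpace Y]
    (x : X) (y : Y) : TopologicalSpace (Wedge x y) :=
  inferInstanceAs (TopologicalSpace (Quot (WedgeRel x y)))

/-! Write K for Ind(G ∖ N[e]). A vertex outside N[e] is adjacent to neither end of e, so Ind(e ⊔ (G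
∖ N[e])) is the suspension of K with poles u and v.

Null-homotopy: the complement of P₄ is again P₄, so v and u are joined inside {x, y, u, v} by a walk
v, c, d, u whose consecutive vertices are equal or non-adjacent in G. All four vertices have their
neighbours in N[e], so each is compatible with every simplex of K. The pole v can therefore be
pushed to c, d and u through contiguous maps (`move_homotopic_move`), which ends in the cone u * K
(`homotopic_const_vertex`).

Splitting: the simplices of Ind(G - e) missing from Ind(G) are {u, v} ∪ σ with σ empty or a simplex
of K. They fill in a cone over ΣK with apex the midpoint of e, so Ind(G - e) is the mapping cone of
ΣK → Ind(G) (`coneHomeomorph`). Up to homotopy equivalence, the cone depends only on the homotopy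
class of the map (`MappingCone.homotopyEquiv`), and for a constant map it is the wedge with Σ²K
(`MappingCone.constHomeomorph`). -/

/-- The identifications in the mapping cone of `f`: the bottom of the cylinder `A × I` is glued to
`X` along `f`, its top is collapsed to the apex. -/
inductive MappingConeRel {A X : Type*} (f : A → X) :
    X ⊕ ((A × unitInterval) ⊕ Unit) → X ⊕ ((A × unitInterval) ⊕ Unit) → Prop
  | base (a : A) : MappingConeRel f (Sum.inr (Sum.inl (a, 0))) (Sum.inl (f a))
  | apex (a : A) : MappingConeRel f (Sum.inr (Sum.inl (a, 1))) (Sum.inr (Sum.inr ()))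

/-- The (unreduced) mapping cone of `f`. -/
def MappingCone {A X : Type*} (f : A → X) : Type _ := Quot (MappingConeRel f)

namespace MappingCone

/-! ### Mapping cones -/

section Basic

variable {A X Z : Type*} {f : A → X}

/-- A point of the target as a point of the mapping cone. -/
def inl (f : A → X) (x : X) : MappingCone f := Quot.mk _ (Sum.inl x)

/-- A point of the cylinder as a point of the mapping cone. -/
def cyl (f : A → X) (p : A × unitInterval) : MappingCone f := Quot.mk _ (Sum.inr (Sum.inl p))

/-- The apex of the mapping cone. -/
def apex (f : A → X) : MappingCone f := Quot.mk _ (Sum.inr (Sum.inr ()))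

lemma cyl_zero (a : A) : cyl f (a, 0) = inl f (f a) := Quot.sound (.base a)

lemma cyl_one (a : A) : cyl f (a, 1) = apex f := Quot.sound (.apex a)

@[elab_as_elim]
lemma ind {p : MappingCone f → Prop} (hX : ∀ x, p (inl f x)) (hc : ∀ q, p (cyl f q))
    (ha : p (apex f)) (z : MappingCone f) : p z := by
  rcases z with ⟨x | q | ⟨⟩⟩
  exacts [hX x, hc q, ha]

/-- Maps out of the mapping cone. -/
def lift (i : X → Z) (c : A × unitInterval → Z) (z : Z) (h0 : ∀ a, c (a, 0) = i (f a))
    (h1 : ∀ a, c (a, 1) = z) : MappingCone f → Z :=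
  Quot.lift (Sum.elim i (Sum.elim c fun _ => z)) (by
    rintro _ _ (a | a)
    exacts [h0 a, h1 a])

variable [TopologicalSpace A] [TopologicalSpace X] [TopologicalSpace Z]

instance : TopologicalSpace (MappingCone f) := inferInstanceAs (TopologicalSpace (Quot _))

instance [CompactSpace A] [CompactSpace X] : CompactSpace (MappingCone f) :=
  inferInstanceAs (CompactSpace (Quot _))

lemma continuous_inl : Continuous (inl f) := continuous_quot_mk.comp _root_.continuous_inl

lemma continuous_cyl : Continuous (cyl f) :=
  continuous_quot_mk.comp (_root_.continuous_inr.comp _root_.continuous_inl)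

lemma continuous_lift {i : X → Z} {c : A × unitInterval → Z} {z : Z}
    {h0 : ∀ a, c (a, 0) = i (f a)} {h1 : ∀ a, c (a, 1) = z} (hi : Continuous i)
    (hc : Continuous c) : Continuous (lift i c z h0 h1) :=
  continuous_quot_lift _ (hi.sumElim (hc.sumElim continuous_const))

end Basic

/-! ### Homotopy invariance of the mapping cone -/

section Homotopy

variable {A X : Type*} [TopologicalSpace A] [TopologicalSpace X] {f g : C(A, X)}

/-- The track of `a` under a homotopy from `f` to `g`, run backwards on `[-1, 0]` and followed on
`[0, 1]` by the generator through `a` of the mapping cone of `f`. -/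
noncomputable def track (h : f.Homotopy g) (p : A × ℝ) : MappingCone f :=
  if p.2 ≤ 0 then inl f (h (Set.projIcc 0 1 zero_le_one (-p.2), p.1))
  else cyl f (p.1, Set.projIcc 0 1 zero_le_one p.2)

lemma continuous_track (h : f.Homotopy g) : Continuous (track h) := by
  refine Continuous.if_le ?_ ?_ continuous_snd continuous_const ?_
  · exact continuous_inl.comp (h.continuous.comp
      ((continuous_projIcc.comp continuous_snd.neg).prodMk continuous_fst))
  · exact continuous_cyl.comp (continuous_fst.prodMk (continuous_projIcc.comp continuous_snd))
  · rintro ⟨a, r⟩ (rfl : r = 0)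
    simp [Set.projIcc_left, ← cyl_zero]

lemma track_neg (h : f.Homotopy g) (a : A) (t : unitInterval) :
    track h (a, -t) = inl f (h (t, a)) := by
  simp [track, t.2.1]

lemma track_coe (h : f.Homotopy g) (a : A) (t : unitInterval) :
    track h (a, t) = cyl f (a, t) := by
  rcases eq_or_ne t 0 with rfl | ht
  · simpa [cyl_zero] using track_neg h a 0
  · have : ¬ (t : ℝ) ≤ 0 := fun h => ht (Subtype.ext (le_antisymm h t.2.1))
    simp [track, this]

lemma track_zero (h : f.Homotopy g) (a : A) : track h (a, 0) = inl f (f a) := by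
  simpa using track_neg h a 0

lemma track_neg_one (h : f.Homotopy g) (a : A) : track h (a, -1) = inl f (g a) := by
  simpa using track_neg h a 1

lemma track_one (h : f.Homotopy g) (a : A) : track h (a, 1) = apex f := by
  simpa [cyl_one] using track_coe h a 1

/-- The map between the mapping cones of homotopic maps. -/
noncomputable def map (h : f.Homotopy g) : C(MappingCone g, MappingCone f) where
  toFun := lift (inl f) (fun p => track h (p.1, 2 * (p.2 : ℝ) - 1)) (apex f)
    (fun a => by simpa using track_neg_one h a)
    (fun a => by simpa [show (2 : ℝ) - 1 = 1 by norm_num] using track_one h a)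
  continuous_toFun := continuous_lift continuous_inl
    ((continuous_track h).comp (by fun_prop))

@[simp] lemma map_inl (h : f.Homotopy g) (x : X) : map h (inl g x) = inl f x := rfl

lemma map_cyl (h : f.Homotopy g) (a : A) (t : unitInterval) :
    map h (cyl g (a, t)) = track h (a, 2 * (t : ℝ) - 1) := rfl

/-- The round trip follows the track from 0 back to -1, reached at t = 1/2, and then forward to 1.
The maximum of the two affine pieces gives one parameter, which can be deformed linearly to t. -/
lemma map_map_cyl (h : f.Homotopy g) (a : A) (t : unitInterval) :
    map h (map h.symm (cyl f (a, t))) = track h (a, max (-(2 * t)) (4 * t - 3)) := by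
  rw [map_cyl]
  rcases le_total (t : ℝ) (1 / 2) with ht | ht
  · have e : 2 * (t : ℝ) - 1 = -((⟨1 - 2 * t, by linarith, by linarith [t.2.1]⟩ : unitInterval) : ℝ) := by
      simp
    have e' : max (-(2 * (t : ℝ))) (4 * t - 3)
        = -((⟨2 * t, by linarith [t.2.1], by linarith⟩ : unitInterval) : ℝ) := by
      rw [max_eq_left]; linarith
    rw [e, e', track_neg, track_neg, map_inl, ContinuousMap.Homotopy.symm_apply]
    congr 3
    ext
    simp
  · have e : 2 * (t : ℝ) - 1 = ((⟨2 * t - 1, by linarith, by linarith [t.2.2]⟩ : unitInterval) : ℝ) := by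
      simp
    rw [e, track_coe, map_cyl, max_eq_right (by linarith)]
    congr 2
    simp; ring

lemma map_comp_map_symm_homotopic (h : f.Homotopy g) :
    ((map h).comp (map h.symm)).Homotopic (ContinuousMap.id _) := by
  let c : C((A × unitInterval) × unitInterval, MappingCone f) :=
    ⟨fun q => track h (q.1.1, (1 - (q.2 : ℝ)) * max (-(2 * (q.1.2 : ℝ))) (4 * q.1.2 - 3) + q.2 * q.1.2),
      (continuous_track h).comp (by fun_prop)⟩
  -- With values in the path space, the homotopy is a map out of a quotient alone, so no product of
  -- a quotient map with the interval has to be examined. The interpolation fixes the parameters 0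
  -- and 1, hence respects the gluing.
  let F : MappingCone f → C(unitInterval, MappingCone f) :=
    lift (fun x => ContinuousMap.const _ (inl f x)) c.curry (ContinuousMap.const _ (apex f))
      (fun a => by
        ext s
        simp [c, track_zero])
      (fun a => by
        ext s
        have : max (-2 : ℝ) (4 - 3) = 1 := by norm_num
        simp [c, this, track_one])
  have hF : Continuous F :=
    continuous_lift (ContinuousMap.continuous_const'.comp continuous_inl) c.curry.continuous
  refine ⟨⟨⟨fun p => F p.2 p.1, ?_⟩, fun z => ?_, fun z => ?_⟩⟩
  · exact ((hF.comp continuous_snd).eval continuous_fst)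
  · induction z using ind with
    | hX x => rfl
    | hc q =>
      refine Eq.trans ?_ (map_map_cyl h q.1 q.2).symm
      simp [F, lift, cyl, c]
    | ha => rfl
  · induction z using ind with
    | hX x => rfl
    | hc q =>
      refine Eq.trans ?_ (track_coe h q.1 q.2)
      simp [F, lift, cyl, c]
    | ha => rfl

/-- Homotopic maps have homotopy equivalent mapping cones. -/
noncomputable def homotopyEquiv (h : f.Homotopy g) :
    ContinuousMap.HomotopyEquiv (MappingCone f) (MappingCone g) where
  toFun := map h.symm
  invFun := map h
  left_inv := map_comp_map_symm_homotopic h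
  right_inv := by simpa using map_comp_map_symm_homotopic h.symm

end Homotopy

/-! ### The mapping cone of a constant map -/

section Const

variable {A X : Type*} [TopologicalSpace A] [TopologicalSpace X]

open unitInterval in
/-- The mapping cone of a constant map is a wedge with the suspension. -/
noncomputable def constHomeomorph (A : Type*) [TopologicalSpace A] (a : X) :
    MappingCone (ContinuousMap.const A a) ≃ₜ Wedge a (Suspension.pole A) where
  toFun := lift (fun x => Quot.mk _ (Sum.inl x))
    -- The cylinder is reversed: the cone meets X at parameter 0, the wedge point is the pole at
    -- parameter 1.
    (fun p => Quot.mk _ (Sum.inr (Quot.mk _ (Sum.inl (p.1, σ p.2)))))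
    (Quot.mk _ (Sum.inr (Quot.mk _ (Sum.inr false))))
    (fun b => by
      rw [symm_zero]
      exact (congrArg (fun s => Quot.mk _ (Sum.inr s)) (Quot.sound (.one b))).trans
        (Quot.sound .glue).symm)
    (fun b => by
      rw [symm_one]
      exact congrArg (fun s => Quot.mk _ (Sum.inr s)) (Quot.sound (.zero b)))
  invFun := Quot.lift (Sum.elim (inl _) (Quot.lift
      (Sum.elim (fun p => cyl _ (p.1, σ p.2)) (fun b => bif b then inl _ a else apex _)) (by
        rintro _ _ (b | b)
        · simp [cyl_one]
        · simp [cyl_zero]))) (by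
      rintro _ _ ⟨⟩
      rfl)
  left_inv z := by
    induction z using ind with
    | hX x => rfl
    | hc q =>
      change cyl _ (q.1, σ (σ q.2)) = cyl _ q
      rw [symm_symm]
    | ha => rfl
  right_inv z := by
    rcases z with ⟨x | ⟨⟨p | (_ | _)⟩⟩⟩
    · rfl
    · change Quot.mk _ (Sum.inr (Quot.mk _ (Sum.inl (p.1, σ (σ p.2))))) = _
      rw [symm_symm]
      rfl
    · rfl
    · exact Quot.sound .glue
  continuous_toFun := continuous_lift (continuous_quot_mk.comp _root_.continuous_inl)
    (continuous_quot_mk.comp (_root_.continuous_inr.comp (continuous_quot_mk.comp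
      (_root_.continuous_inl.comp (continuous_fst.prodMk
        (continuous_symm.comp continuous_snd))))))
  continuous_invFun := continuous_quot_lift _ (continuous_inl.sumElim (continuous_quot_lift _
    ((continuous_cyl.comp (continuous_fst.prodMk
      (continuous_symm.comp continuous_snd))).sumElim continuous_of_discreteTopology)))

end Const

end MappingCone

namespace SimpleGraph

/-! ### Points of the independence complex and contiguous maps -/

section Points

variable {V : Type*} {G : SimpleGraph V}

/-- A point of `Ind(G)` from its barycentric coordinates. -/
noncomputable def Ind.mk [Fintype V] (p : V → ℝ) (h0 : ∀ w, 0 ≤ p w) (h1 : ∑ w, p w = 1)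
    (hi : ∀ a b, p a ≠ 0 → p b ≠ 0 → ¬ G.Adj a b) : G.Ind :=
  ⟨p, h0, by
    classical
    have hsum : ∑ w ∈ Finset.univ.filter (fun w => p w ≠ 0), p w = 1 := by
      rw [Finset.sum_filter_ne_zero, h1]
    refine ⟨Finset.univ.filter (fun w => p w ≠ 0), ⟨?_, fun a ha b hb _ => ?_⟩, by simp, hsum⟩
    · exact Finset.nonempty_of_sum_ne_zero (hsum.trans_ne one_ne_zero)
    · exact hi a b (by simpa using ha) (by simpa using hb)⟩

lemma Ind.sum_eq_one [Fintype V] (p : G.Ind) : ∑ w, p.1 w = 1 := by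
  obtain ⟨p, -, s, -, h0, h1⟩ := p
  exact (Finset.sum_subset s.subset_univ fun w _ hw => h0 w hw).symm.trans h1

lemma Ind.not_adj (p : G.Ind) {a b : V} (ha : p.1 a ≠ 0) (hb : p.1 b ≠ 0) : ¬ G.Adj a b := by
  obtain ⟨-, s, hs, h0, -⟩ := p.2
  intro h
  exact hs.2 (not_imp_comm.1 (h0 a) ha) (not_imp_comm.1 (h0 b) hb) h.ne h

lemma Ind.nonneg (p : G.Ind) (w : V) : 0 ≤ p.1 w := p.2.1 w

lemma Ind.continuous_coord (w : V) : Continuous fun p : G.Ind => p.1 w :=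
  (continuous_apply w).comp continuous_subtype_val

/-- Contiguous maps to `Ind(G)` are homotopic, along straight lines. -/
lemma Ind.homotopic_of_contiguous [Fintype V] {Z : Type*} [TopologicalSpace Z] (f g : C(Z, G.Ind))
    (h : ∀ z a b, (f z).1 a ≠ 0 → (g z).1 b ≠ 0 → ¬ G.Adj a b) : f.Homotopic g := by
  let p : unitInterval × Z → V → ℝ := fun q w =>
    (1 - (q.1 : ℝ)) * (f q.2).1 w + q.1 * (g q.2).1 w
  have hp : ∀ q w, p q w ≠ 0 → (f q.2).1 w ≠ 0 ∨ (g q.2).1 w ≠ 0 := fun q w hw => by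
    by_contra! hc
    exact hw (by simp [p, hc.1, hc.2])
  let F : unitInterval × Z → G.Ind := fun q => Ind.mk (p q)
    (fun w => add_nonneg (mul_nonneg (by linarith [q.1.2.2]) (Ind.nonneg _ w))
      (mul_nonneg q.1.2.1 (Ind.nonneg _ w)))
    (by simp [p, Finset.sum_add_distrib, ← Finset.mul_sum, Ind.sum_eq_one])
    (fun a b ha hb => by
      rcases hp q a ha with ha | ha <;> rcases hp q b hb with hb | hb
      · exact (f q.2).not_adj ha hb
      · exact h _ a b ha hb
      · exact fun hab => h _ b a hb ha hab.symm
      · exact (g q.2).not_adj ha hb)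
  refine ⟨⟨⟨F, ?_⟩, fun z => Subtype.ext (funext fun w => ?_),
    fun z => Subtype.ext (funext fun w => ?_)⟩⟩
  · refine Continuous.subtype_mk (continuous_pi fun w => ?_) _
    have h1 : Continuous fun q : unitInterval × Z => (f q.2).1 w :=
      (Ind.continuous_coord w).comp (f.continuous.comp continuous_snd)
    have h2 : Continuous fun q : unitInterval × Z => (g q.2).1 w :=
      (Ind.continuous_coord w).comp (g.continuous.comp continuous_snd)
    have h0 : Continuous fun q : unitInterval × Z => (q.1 : ℝ) :=
      continuous_subtype_val.comp continuous_fst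
    exact ((continuous_const.sub h0).mul h1).add (h0.mul h2)
  · simp [F, p, Ind.mk]
  · simp [F, p, Ind.mk]

lemma Ind.vertex_apply [DecidableEq V] (v w : V) :
    (G.indComplex.vertex v).1 w = if w = v then 1 else 0 := by
  simp [AbstractSimplicialComplex.vertex]

lemma Ind.ne_zero_vertex {v w : V} (h : (G.indComplex.vertex v).1 w ≠ 0) : w = v := by
  classical
  by_contra hw
  exact h (by simp [vertex_apply, hw])

end Points

/-! ### Pushing one vertex to another -/

section Move

variable {V : Type*} {G : SimpleGraph V} {Z : Type*} [TopologicalSpace Z]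

open Classical in
/-- The coordinates of the push-forward of `p` under the map sending `v` to `c`. -/
noncomputable def moveCoord (v c : V) (p : V → ℝ) (w : V) : ℝ :=
  (if w = v then 0 else p w) + if w = c then p v else 0

lemma moveCoord_ne_zero {v c : V} {p : V → ℝ} {w : V} (h : moveCoord v c p w ≠ 0) :
    (w ≠ v ∧ p w ≠ 0) ∨ (w = c ∧ p v ≠ 0) := by
  unfold moveCoord at h
  by_contra! hc
  apply h
  split_ifs <;> simp_all

variable [Fintype V]

/-- Moving the `v`-coordinate of a map to `Ind(G)` to the vertex `c`. -/
noncomputable def move (f : C(Z, G.Ind)) (v c : V)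
    (hc : ∀ z w, (f z).1 w ≠ 0 → (f z).1 v ≠ 0 → w ≠ v → ¬ G.Adj c w) : C(Z, G.Ind) where
  toFun z := Ind.mk (moveCoord v c (f z).1)
    (fun w => by
      have := (f z).nonneg
      unfold moveCoord
      split_ifs <;> simp [this, add_nonneg])
    (by
      classical
      refine Eq.trans ?_ (f z).sum_eq_one
      unfold moveCoord
      rw [Finset.sum_add_distrib, ← Finset.sum_erase_add _ _ (Finset.mem_univ v),
        ← Finset.sum_erase_add _ (f z).1 (Finset.mem_univ v)]
      simp only [if_true, Finset.sum_ite_eq', Finset.mem_univ, add_zero]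
      congr 1
      exact Finset.sum_congr rfl fun w hw => if_neg (Finset.ne_of_mem_erase hw))
    (fun a b ha hb => by
      rcases moveCoord_ne_zero ha with ⟨hav, ha'⟩ | ⟨rfl, ha'⟩ <;>
        rcases moveCoord_ne_zero hb with ⟨hbv, hb'⟩ | ⟨rfl, hb'⟩
      · exact (f z).not_adj ha' hb'
      · exact fun h => hc z a ha' hb' hav h.symm
      · exact hc z b hb' ha' hbv
      · exact G.irrefl)
  continuous_toFun := by
    refine Continuous.subtype_mk (continuous_pi fun w => ?_) _
    have h : ∀ w, Continuous fun z => (f z).1 w := fun w =>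
      (Ind.continuous_coord w).comp f.continuous
    unfold moveCoord
    split_ifs <;> fun_prop

/-- The two maps are contiguous: away from c and d both are supported on the old simplex, with which
c and d are compatible, and c and d are compatible with each other. -/
lemma move_homotopic_move (f : C(Z, G.Ind)) (v c d : V)
    (hc : ∀ z w, (f z).1 w ≠ 0 → (f z).1 v ≠ 0 → w ≠ v → ¬ G.Adj c w)
    (hd : ∀ z w, (f z).1 w ≠ 0 → (f z).1 v ≠ 0 → w ≠ v → ¬ G.Adj d w)
    (hcd : ¬ G.Adj c d) : (move f v c hc).Homotopic (move f v d hd) := by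
  refine Ind.homotopic_of_contiguous _ _ fun z a b ha hb => ?_
  rcases moveCoord_ne_zero ha with ⟨hav, ha'⟩ | ⟨rfl, ha'⟩ <;>
    rcases moveCoord_ne_zero hb with ⟨hbv, hb'⟩ | ⟨rfl, hb'⟩
  · exact (f z).not_adj ha' hb'
  · exact fun h => hd z a ha' hb' hav h.symm
  · exact hc z b hb' ha' hbv
  · exact hcd

lemma homotopic_move (f : C(Z, G.Ind)) (v c : V)
    (hc : ∀ z w, (f z).1 w ≠ 0 → (f z).1 v ≠ 0 → w ≠ v → ¬ G.Adj c w)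
    (hvc : ¬ G.Adj v c) : f.Homotopic (move f v c hc) := by
  refine Ind.homotopic_of_contiguous _ _ fun z a b ha hb => ?_
  rcases moveCoord_ne_zero hb with ⟨hbv, hb'⟩ | ⟨rfl, hb'⟩
  · exact (f z).not_adj ha hb'
  · rcases eq_or_ne a v with rfl | hav
    · exact hvc
    · exact fun h => hc z a ha hb' hav h.symm

/-- A map to `Ind(G)` whose image lies in `Ind(e ⊔ (G ∖ N[e]))` is null-homotopic, if the ends of
`e` can be connected by a walk of length three in the complement of `G` that stays away from
`G ∖ N[e]`. -/
lemma homotopic_const_vertex (f : C(Z, G.Ind)) {u v c d : V} (he : G.Adj u v)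
    (hf : ∀ z w, (f z).1 w ≠ 0 → w = u ∨ w = v ∨ w ∉ G.edgeNbhd u v)
    (hvc : ¬ G.Adj v c) (hcd : ¬ G.Adj c d) (hdu : ¬ G.Adj d u)
    (hc : ∀ w, w ∉ G.edgeNbhd u v → ¬ G.Adj c w) (hd : ∀ w, w ∉ G.edgeNbhd u v → ¬ G.Adj d w) :
    f.Homotopic (ContinuousMap.const Z (G.indComplex.vertex u)) := by
  have hu : ∀ w, w ∉ G.edgeNbhd u v → ¬ G.Adj u w := fun w hw h => hw (Or.inl (Or.inr h))
  -- Where the v-coordinate is positive the u-coordinate vanishes, so the rest of the support lies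
  -- outside N[e]. Any vertex without neighbours there may replace v.
  have key : ∀ c, (∀ w, w ∉ G.edgeNbhd u v → ¬ G.Adj c w) → ∀ z w, (f z).1 w ≠ 0 →
      (f z).1 v ≠ 0 → w ≠ v → ¬ G.Adj c w := fun c hc z w hw hv hwv => by
    rcases hf z w hw with rfl | rfl | h
    · exact absurd he ((f z).not_adj hw hv)
    · exact absurd rfl hwv
    · exact hc w h
  refine (homotopic_move f v c (key c hc) hvc).trans
    ((move_homotopic_move f v c d (key c hc) (key d hd) hcd).trans
    ((move_homotopic_move f v d u (key d hd) (key u hu) hdu).trans ?_))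
  -- After the last push the support lies in u and the vertices outside N[e], a cone with apex u.
  refine Ind.homotopic_of_contiguous _ _ fun z a b ha hb => ?_
  obtain rfl := Ind.ne_zero_vertex hb
  rcases moveCoord_ne_zero ha with ⟨hav, ha'⟩ | ⟨rfl, ha'⟩
  · rcases hf z a ha' with rfl | rfl | h
    · exact G.irrefl
    · exact absurd rfl hav
    · exact fun h' => hu a h h'.symm
  · exact G.irrefl

end Move

/-! ### The walk in the complement of the path -/

section Path

/-- Adjacent vertices of the four-vertex path are joined by a walk of length at most three in
the complement. -/
lemma exists_compl_walk_pathGraph_four (i j : Fin 4) : ∃ c d : Fin 4,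
    ¬ (pathGraph 4).Adj i c ∧ ¬ (pathGraph 4).Adj c d ∧ ¬ (pathGraph 4).Adj d j := by
  -- The complement of P₄ is a path, of diameter three; shorter walks are padded by pauses, since a
  -- vertex is not adjacent to itself.
  simp only [pathGraph_adj]
  revert i j
  decide

/-- The walk in P₄ is carried back along the isomorphism. Its vertices have no neighbours outside
N[e]: for x and y by hypothesis, for u and v by definition of N[e]. -/
lemma exists_compl_walk {V : Type*} {G : SimpleGraph V} {u v x y : V}
    (hN : G.closedNbhd x ∪ G.closedNbhd y ⊆ G.edgeNbhd u v)
    (hP : Nonempty (G.induce {x, y, u, v} ≃g pathGraph 4)) :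
    ∃ c d, ¬ G.Adj v c ∧ ¬ G.Adj c d ∧ ¬ G.Adj d u ∧
      (∀ w, w ∉ G.edgeNbhd u v → ¬ G.Adj c w) ∧ ∀ w, w ∉ G.edgeNbhd u v → ¬ G.Adj d w := by
  obtain ⟨φ⟩ := hP
  obtain ⟨c, d, h1, h2, h3⟩ := exists_compl_walk_pathGraph_four
    (φ ⟨v, by simp⟩) (φ ⟨u, by simp⟩)
  obtain ⟨c, rfl⟩ := φ.surjective c
  obtain ⟨d, rfl⟩ := φ.surjective d
  rw [φ.map_adj_iff] at h1 h2 h3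
  have key : ∀ c ∈ ({x, y, u, v} : Set V), ∀ w, w ∉ G.edgeNbhd u v → ¬ G.Adj c w := by
    rintro c (rfl | rfl | rfl | rfl) w hw h
    · exact hw (hN (Or.inl (Or.inr h)))
    · exact hw (hN (Or.inr (Or.inr h)))
    · exact hw (Or.inl (Or.inr h))
    · exact hw (Or.inr (Or.inr h))
  exact ⟨c, d, h1, h2, h3, key c c.2, key d d.2⟩

end Path

lemma indInclusion_apply_mem {V : Type*} {G : SimpleGraph V} {W : Set V} (p : (G.induce W).Ind)
    (w : W) : (G.indInclusion W p).1 w = p.1 w :=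
  Subtype.val_injective.extend_apply p.1 0 w

lemma indInclusion_apply_notMem {V : Type*} {G : SimpleGraph V} {W : Set V}
    (p : (G.induce W).Ind) {w : V} (hw : w ∉ W) : (G.indInclusion W p).1 w = 0 :=
  Function.extend_apply' _ _ _ (by rintro ⟨w, rfl⟩; exact hw w.2)

end SimpleGraph

/-! ### Compactness and separation -/

namespace AbstractSimplicialComplex.Realization

variable {V : Type*} (K : AbstractSimplicialComplex V)

instance : T2Space K.Realization :=
  inferInstanceAs (T2Space {p : V → ℝ // (∀ v, 0 ≤ p v) ∧
    ∃ s ∈ K.faces, (∀ v, v ∉ s → p v = 0) ∧ ∑ v ∈ s, p v = 1})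

instance [Finite V] : CompactSpace K.Realization := by
  refine (isCompact_iff_compactSpace (s := {p : V → ℝ | (∀ v, 0 ≤ p v) ∧
    ∃ s ∈ K.faces, (∀ v, v ∉ s → p v = 0) ∧ ∑ v ∈ s, p v = 1})).1 ?_
  refine (isCompact_Icc (a := (0 : V → ℝ)) (b := 1)).of_isClosed_subset ?_ ?_
  -- Closedness: the realization is a finite union of closed simplices.
  · have : {p : V → ℝ | (∀ v, 0 ≤ p v) ∧
        ∃ s ∈ K.faces, (∀ v, v ∉ s → p v = 0) ∧ ∑ v ∈ s, p v = 1} =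
        (⋂ v, {p | 0 ≤ p v}) ∩ ⋃ s ∈ K.faces, ((⋂ v, ⋂ (_ : v ∉ s), {p | p v = 0}) ∩
          {p | ∑ v ∈ s, p v = 1}) := by
      ext p
      simp only [Set.mem_ofPred_eq, Set.mem_inter_iff, Set.mem_iInter, Set.mem_iUnion, exists_prop]
    rw [this]
    refine (isClosed_iInter fun v => isClosed_le continuous_const (continuous_apply v)).inter
      (Set.Finite.isClosed_biUnion (Set.toFinite _) fun s _ => IsClosed.inter
        (isClosed_iInter fun v => isClosed_iInter fun _ =>
          isClosed_eq (continuous_apply v) continuous_const)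
        (isClosed_eq (by fun_prop) continuous_const))
  · rintro p ⟨h0, s, -, hs, h1⟩
    refine ⟨h0, fun v => ?_⟩
    by_cases hv : v ∈ s
    · exact (Finset.single_le_sum (fun w _ => h0 w) hv).trans_eq h1
    · simp [hs v hv]

end AbstractSimplicialComplex.Realization

instance (A : Type*) [TopologicalSpace A] [CompactSpace A] : CompactSpace (Suspension A) :=
  inferInstanceAs (CompactSpace (Quot _))

/-- Every point of a suspension is a pole or lies on the open cylinder. -/
lemma Suspension.cases_pole {A : Type*} (z : Suspension A) :
    z = Quot.mk _ (Sum.inr false) ∨ z = Quot.mk _ (Sum.inr true) ∨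
      ∃ (a : A) (t : unitInterval), (0 : ℝ) < t ∧ (t : ℝ) < 1 ∧ z = Quot.mk _ (Sum.inl (a, t)) := by
  rcases z with ⟨⟨a, t⟩ | (_ | _)⟩
  · rcases t.2.1.eq_or_lt with h | h
    · obtain rfl : t = 0 := Subtype.ext h.symm
      exact Or.inl (Quot.sound (.zero a))
    rcases t.2.2.eq_or_lt with h' | h'
    · obtain rfl : t = 1 := Subtype.ext h'
      exact Or.inr (Or.inl (Quot.sound (.one a)))
    · exact Or.inr (Or.inr ⟨a, t, h, h', rfl⟩)
  · exact Or.inl rfl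
  · exact Or.inr (Or.inl rfl)

namespace SimpleGraph

variable {V : Type*} {G : SimpleGraph V} {u v : V}

lemma Ind.vertex_self (v : V) : (G.indComplex.vertex v).1 v = 1 := by
  classical
  simp [vertex_apply]

lemma Ind.vertex_of_ne {v w : V} (h : w ≠ v) : (G.indComplex.vertex v).1 w = 0 := by
  classical
  simp [vertex_apply, h]

lemma left_mem_edgeNbhd (G : SimpleGraph V) (u v : V) : u ∈ G.edgeNbhd u v :=
  Or.inl (Or.inl rfl)

lemma right_mem_edgeNbhd (G : SimpleGraph V) (u v : V) : v ∈ G.edgeNbhd u v :=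
  Or.inr (Or.inl rfl)

lemma not_adj_left {w : V} (hw : w ∉ G.edgeNbhd u v) : ¬ G.Adj u w :=
  fun h => hw (Or.inl (Or.inr h))

lemma not_adj_right {w : V} (hw : w ∉ G.edgeNbhd u v) : ¬ G.Adj v w :=
  fun h => hw (Or.inr (Or.inr h))

/-! ### The suspension of Ind(G ∖ N[e]) inside Ind(G) -/

section Suspension

/-- The barycentric coordinates of a point of the suspension of `Ind(G ∖ N[e])` in
`Ind(e ⊔ (G ∖ N[e]))`. -/
noncomputable def suspCoord (G : SimpleGraph V) (u v : V)
    (p : (G.induce (G.edgeNbhd u v)ᶜ).Ind × unitInterval) (w : V) : ℝ :=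
  -- Parameter 0 is u, parameter 1 is v, and the equator 1/2 is Ind(G ∖ N[e]); the three weights sum
  -- to 1.
  max (1 - 2 * (p.2 : ℝ)) 0 * (G.indComplex.vertex u).1 w +
    max (2 * (p.2 : ℝ) - 1) 0 * (G.indComplex.vertex v).1 w +
    (1 - |2 * (p.2 : ℝ) - 1|) * (G.indInclusion _ p.1).1 w

lemma suspCoord_left (he : G.Adj u v) (p : (G.induce (G.edgeNbhd u v)ᶜ).Ind × unitInterval) :
    suspCoord G u v p u = max (1 - 2 * (p.2 : ℝ)) 0 := by
  simp [suspCoord, Ind.vertex_self, Ind.vertex_of_ne he.ne,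
    indInclusion_apply_notMem p.1 (not_not_intro (left_mem_edgeNbhd G u v))]

lemma suspCoord_right (he : G.Adj u v) (p : (G.induce (G.edgeNbhd u v)ᶜ).Ind × unitInterval) :
    suspCoord G u v p v = max (2 * (p.2 : ℝ) - 1) 0 := by
  simp [suspCoord, Ind.vertex_self, Ind.vertex_of_ne he.ne',
    indInclusion_apply_notMem p.1 (not_not_intro (right_mem_edgeNbhd G u v))]

lemma suspCoord_compl (p : (G.induce (G.edgeNbhd u v)ᶜ).Ind × unitInterval)
    (w : ↑(G.edgeNbhd u v)ᶜ) :
    suspCoord G u v p w = (1 - |2 * (p.2 : ℝ) - 1|) * p.1.1 w := by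
  have hu : (w : V) ≠ u := fun h => w.2 (by rw [h]; exact left_mem_edgeNbhd G u v)
  have hv : (w : V) ≠ v := fun h => w.2 (by rw [h]; exact right_mem_edgeNbhd G u v)
  rw [suspCoord, Ind.vertex_of_ne hu, Ind.vertex_of_ne hv, indInclusion_apply_mem]
  ring

lemma suspCoord_ne_zero {p : (G.induce (G.edgeNbhd u v)ᶜ).Ind × unitInterval} {w : V}
    (hw : suspCoord G u v p w ≠ 0) : w = u ∨ w = v ∨ w ∉ G.edgeNbhd u v := by
  by_contra! h
  apply hw
  rw [suspCoord, Ind.vertex_of_ne h.1, Ind.vertex_of_ne h.2.1,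
    indInclusion_apply_notMem p.1 (not_not_intro h.2.2)]
  ring

lemma suspCoord_not_adj (he : G.Adj u v) {p : (G.induce (G.edgeNbhd u v)ᶜ).Ind × unitInterval}
    {a b : V} (ha : suspCoord G u v p a ≠ 0) (hb : suspCoord G u v p b ≠ 0) : ¬ G.Adj a b := by
  have huv : suspCoord G u v p u ≠ 0 → suspCoord G u v p v = 0 := by
    rw [suspCoord_left he, suspCoord_right he]
    intro h
    refine max_eq_right (not_lt.1 fun h' => h (max_eq_right (by linarith)))
  rcases suspCoord_ne_zero ha with rfl | rfl | ha' <;>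
    rcases suspCoord_ne_zero hb with rfl | rfl | hb'
  · exact G.irrefl
  · exact absurd (huv ha) hb
  · exact not_adj_left hb'
  · exact absurd (huv hb) ha
  · exact G.irrefl
  · exact not_adj_right hb'
  · exact fun h => not_adj_left ha' h.symm
  · exact fun h => not_adj_right ha' h.symm
  · lift a to ↑(G.edgeNbhd u v)ᶜ using ha'
    lift b to ↑(G.edgeNbhd u v)ᶜ using hb'
    rw [suspCoord_compl] at ha hb
    exact p.1.not_adj (right_ne_zero_of_mul ha) (right_ne_zero_of_mul hb)

variable [Fintype V]

/-- The map from the suspension of `Ind(G ∖ N[e])` to `Ind(G)` that sends the poles to the ends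
of `e`. -/
noncomputable def suspMap (he : G.Adj u v) :
    C(Suspension (G.induce (G.edgeNbhd u v)ᶜ).Ind, G.Ind) where
  toFun := Quot.lift (Sum.elim
    (fun p => Ind.mk (suspCoord G u v p)
      (fun w => by
        have h : |2 * (p.2 : ℝ) - 1| ≤ 1 := by
          rw [abs_le]
          constructor <;> linarith [p.2.2.1, p.2.2.2]
        exact add_nonneg (add_nonneg (mul_nonneg (le_max_right _ _) (Ind.nonneg _ w))
          (mul_nonneg (le_max_right _ _) (Ind.nonneg _ w)))
          (mul_nonneg (by linarith) (Ind.nonneg _ w)))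
      (by
        simp only [suspCoord, Finset.sum_add_distrib, ← Finset.mul_sum, Ind.sum_eq_one]
        rcases le_total (2 * (p.2 : ℝ)) 1 with h | h
        · rw [max_eq_left (by linarith), max_eq_right (by linarith), abs_of_nonpos (by linarith)]
          ring
        · rw [max_eq_right (by linarith), max_eq_left (by linarith), abs_of_nonneg (by linarith)]
          ring)
      (fun a b => suspCoord_not_adj he))
    (fun b => bif b then G.indComplex.vertex v else G.indComplex.vertex u)) (by
      rintro _ _ (k | k) <;> refine Subtype.ext (funext fun w => ?_)
      · change suspCoord G u v (k, 0) w = (G.indComplex.vertex u).1 w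
        simp [suspCoord]
      · change suspCoord G u v (k, 1) w = (G.indComplex.vertex v).1 w
        have : (2 : ℝ) - 1 = 1 := by norm_num
        simp [suspCoord, this])
  continuous_toFun := by
    refine continuous_quot_lift _ (Continuous.sumElim ?_ continuous_of_discreteTopology)
    refine Continuous.subtype_mk (continuous_pi fun w => ?_) _
    have h : Continuous fun p : (G.induce (G.edgeNbhd u v)ᶜ).Ind × unitInterval =>
        (G.indInclusion _ p.1).1 w :=
      (Ind.continuous_coord w).comp ((G.indInclusion _).continuous.comp continuous_fst)
    exact ((Continuous.mul (by fun_prop) continuous_const).add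
      (Continuous.mul (by fun_prop) continuous_const)).add (Continuous.mul (by fun_prop) h)

lemma suspMap_mk_inl (he : G.Adj u v) (p : (G.induce (G.edgeNbhd u v)ᶜ).Ind × unitInterval) :
    (suspMap he (Quot.mk _ (Sum.inl p))).1 = suspCoord G u v p := rfl

lemma suspMap_mk_false (he : G.Adj u v) :
    suspMap he (Quot.mk _ (Sum.inr false)) = G.indComplex.vertex u := rfl

lemma suspMap_mk_true (he : G.Adj u v) :
    suspMap he (Quot.mk _ (Sum.inr true)) = G.indComplex.vertex v := rfl

lemma suspMap_ne_zero (he : G.Adj u v) (z : Suspension (G.induce (G.edgeNbhd u v)ᶜ).Ind) (w : V)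
    (hw : (suspMap he z).1 w ≠ 0) : w = u ∨ w = v ∨ w ∉ G.edgeNbhd u v := by
  rcases z with ⟨p | (_ | _)⟩
  · exact suspCoord_ne_zero hw
  · exact Or.inl (Ind.ne_zero_vertex hw)
  · exact Or.inr (Or.inl (Ind.ne_zero_vertex hw))

/-- The parameter t is recovered from the difference of the v- and u-coordinates, which is 2t - 1.
Off the poles the remaining weight is nonzero, so it can be cancelled. -/
lemma suspMap_injective (he : G.Adj u v) : Function.Injective (suspMap he) := by
  intro z z' h
  have hu := congrArg (fun p : G.Ind => p.1 u) h
  have hv := congrArg (fun p : G.Ind => p.1 v) h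
  have key : ∀ t : ℝ, max (2 * t - 1) 0 - max (1 - 2 * t) 0 = 2 * t - 1 := fun t => by
    rcases le_total (2 * t) 1 with h | h
    · rw [max_eq_left (a := 1 - 2 * t) (by linarith), max_eq_right (by linarith)]
      ring
    · rw [max_eq_right (a := 1 - 2 * t) (by linarith), max_eq_left (by linarith)]
      ring
  rcases z.cases_pole with rfl | rfl | ⟨k, t, h0, h1, rfl⟩ <;>
    rcases z'.cases_pole with rfl | rfl | ⟨k', t', h0', h1', rfl⟩ <;>
    simp only [suspMap_mk_inl, suspMap_mk_false, suspMap_mk_true, Ind.vertex_self,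
      Ind.vertex_of_ne he.ne, Ind.vertex_of_ne he.ne', suspCoord_left he,
      suspCoord_right he] at hu hv
  · rfl
  · norm_num at hu
  · exact absurd (key t') (by linarith)
  · norm_num at hu
  · rfl
  · exact absurd (key t') (by linarith)
  · exact absurd (key t) (by linarith)
  · exact absurd (key t) (by linarith)
  · obtain rfl : t = t' := Subtype.ext (by linarith [key t, key t'])
    have ht : 1 - |2 * (t : ℝ) - 1| ≠ 0 := by
      have : |2 * (t : ℝ) - 1| < 1 := abs_lt.2 ⟨by linarith, by linarith⟩
      linarith
    obtain rfl : k = k' := Subtype.ext (funext fun w => by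
      have hw := congrArg (fun p : G.Ind => p.1 w) h
      simp only [suspMap_mk_inl, suspCoord_compl] at hw
      exact mul_left_cancel₀ ht hw)
    rfl

/-- At most one of the u- and v-coordinates is nonzero. If the total weight c outside N[e] vanishes,
the point is a pole; otherwise dividing by c gives the point of Ind(G ∖ N[e]). -/
lemma exists_suspMap_eq (he : G.Adj u v) (q : G.Ind)
    (hq : ∀ w, q.1 w ≠ 0 → w = u ∨ w = v ∨ w ∉ G.edgeNbhd u v) : ∃ z, suspMap he z = q := by
  classical
  have hsum : q.1 u + q.1 v + ∑ w : ↑(G.edgeNbhd u v)ᶜ, q.1 w = 1 := by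
    refine Eq.trans ?_ ((Finset.sum_filter_not_add_sum_filter Finset.univ
      (· ∈ (G.edgeNbhd u v)ᶜ) q.1).trans q.sum_eq_one)
    rw [← Finset.sum_subtype (Finset.univ.filter (· ∈ (G.edgeNbhd u v)ᶜ)) (by simp) q.1,
      ← Finset.sum_pair (f := q.1) he.ne]
    congr 1
    refine Finset.sum_subset (fun w hw => ?_) (fun w hw hw' => ?_)
    · rcases Finset.mem_insert.1 hw with rfl | hw
      · simp [left_mem_edgeNbhd]
      · obtain rfl := Finset.mem_singleton.1 hw
        simp [right_mem_edgeNbhd]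
    · by_contra hne
      rcases hq w hne with rfl | rfl | h
      · simp at hw'
      · simp at hw'
      · simp [h] at hw
  have huv : q.1 u = 0 ∨ q.1 v = 0 := by
    by_contra! h
    exact q.not_adj h.1 h.2 he
  set c := ∑ w : ↑(G.edgeNbhd u v)ᶜ, q.1 w with hc
  have hu0 := q.nonneg u
  have hv0 := q.nonneg v
  have hc0 : 0 ≤ c := Finset.sum_nonneg fun w _ => q.nonneg w
  rcases hc0.eq_or_lt with h | h
  · have hw0 : ∀ w : ↑(G.edgeNbhd u v)ᶜ, q.1 w = 0 := fun w =>
      congrFun ((Fintype.sum_eq_zero_iff_of_nonneg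
        (f := fun w : ↑(G.edgeNbhd u v)ᶜ => q.1 w) fun w => q.nonneg w).1 h.symm) w
    have hz : ∀ w, w ≠ u → w ≠ v → q.1 w = 0 := fun w hu hv => by
      by_contra hne
      rcases hq w hne with h | h | h
      exacts [hu h, hv h, hne (hw0 ⟨w, h⟩)]
    rcases huv with h' | h'
    · refine ⟨Quot.mk _ (Sum.inr true), Subtype.ext (funext fun w => ?_)⟩
      rw [suspMap_mk_true]
      by_cases hwv : w = v
      · rw [hwv, Ind.vertex_self]
        linarith
      · rw [Ind.vertex_of_ne hwv]
        by_cases hwu : w = u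
        exacts [hwu ▸ h'.symm, (hz w hwu hwv).symm]
    · refine ⟨Quot.mk _ (Sum.inr false), Subtype.ext (funext fun w => ?_)⟩
      rw [suspMap_mk_false]
      by_cases hwu : w = u
      · rw [hwu, Ind.vertex_self]
        linarith
      · rw [Ind.vertex_of_ne hwu]
        by_cases hwv : w = v
        exacts [hwv ▸ h'.symm, (hz w hwu hwv).symm]
  · let k : (G.induce (G.edgeNbhd u v)ᶜ).Ind := Ind.mk (fun w => q.1 w / c)
      (fun w => div_nonneg (q.nonneg w) hc0)
      (by rw [← Finset.sum_div, ← hc, div_self h.ne'])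
      (fun a b ha hb => q.not_adj (fun h => ha ((congrArg (· / c) h).trans (zero_div c)))
        (fun h => hb ((congrArg (· / c) h).trans (zero_div c))))
    -- The solution of 2t - 1 = q(v) - q(u).
    let t : unitInterval := ⟨(1 + q.1 v - q.1 u) / 2, by linarith, by linarith⟩
    have ht : (t : ℝ) = (1 + q.1 v - q.1 u) / 2 := rfl
    have hk : ∀ w, k.1 w = q.1 w / c := fun w => rfl
    refine ⟨Quot.mk _ (Sum.inl (k, t)), Subtype.ext (funext fun w => ?_)⟩
    rw [suspMap_mk_inl]
    by_cases hwu : w = u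
    · subst hwu
      rw [suspCoord_left he, ht]
      rcases huv with h' | h'
      · rw [max_eq_right] <;> linarith
      · rw [max_eq_left] <;> linarith
    by_cases hwv : w = v
    · subst hwv
      rw [suspCoord_right he, ht]
      rcases huv with h' | h'
      · rw [max_eq_left] <;> linarith
      · rw [max_eq_right] <;> linarith
    by_cases hw : w ∈ (G.edgeNbhd u v)ᶜ
    · lift w to ↑(G.edgeNbhd u v)ᶜ using hw
      have : 1 - |2 * (t : ℝ) - 1| = c := by
        rw [ht]
        rcases huv with h' | h'
        · rw [abs_of_nonneg] <;> linarith
        · rw [abs_of_nonpos] <;> linarith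
      rw [suspCoord_compl, this, hk, mul_div_cancel₀ _ h.ne']
    · have e1 : q.1 w = 0 := by
        by_contra hne
        rcases hq w hne with h | h | h
        exacts [hwu h, hwv h, hw h]
      rw [e1]
      by_contra hne
      rcases suspCoord_ne_zero hne with h | h | h
      exacts [hwu h, hwv h, hw h]

end Suspension

end SimpleGraph

namespace SimpleGraph

/-! ### Ind(G - e) as a mapping cone -/

section Cone

variable {V : Type*} {G : SimpleGraph V} {u v : V}

lemma deleteEdges_pair_adj_of_ne {a b : V} (h : G.Adj a b) (hab : ¬ (a = u ∧ b = v))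
    (hba : ¬ (a = v ∧ b = u)) : (G.deleteEdges {s(u, v)}).Adj a b := by
  rw [deleteEdges_adj]
  refine ⟨h, fun h' => ?_⟩
  rcases Sym2.eq_iff.1 (Set.mem_singleton_iff.1 h') with h' | h'
  exacts [hab h', hba h']

lemma not_deleteEdges_pair_adj {a b : V} (ha : a = u ∨ a = v ∨ a ∉ G.edgeNbhd u v)
    (hb : b = u ∨ b = v ∨ b ∉ G.edgeNbhd u v) (hab : a ∉ G.edgeNbhd u v → b ∉ G.edgeNbhd u v →
      ¬ G.Adj a b) : ¬ (G.deleteEdges {s(u, v)}).Adj a b := by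
  intro h
  obtain ⟨hG, h'⟩ := deleteEdges_adj.1 h
  rcases ha with rfl | rfl | ha <;> rcases hb with rfl | rfl | hb
  · exact G.irrefl hG
  · exact h' rfl
  · exact not_adj_left hb hG
  · exact h' Sym2.eq_swap
  · exact G.irrefl hG
  · exact not_adj_right hb hG
  · exact not_adj_left ha hG.symm
  · exact not_adj_right ha hG.symm
  · exact hab ha hb hG

/-- The coordinates of the point dividing the segment from `p` to the midpoint of the edge `u v`
in the ratio `s : 1 - s`. -/
noncomputable def midCoord (u v : V) (p : G.Ind) (s : unitInterval) (w : V) : ℝ :=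
  (1 - (s : ℝ)) * p.1 w +
    s * ((G.indComplex.vertex u).1 w / 2 + (G.indComplex.vertex v).1 w / 2)

lemma midCoord_left (he : G.Adj u v) (p : G.Ind) (s : unitInterval) :
    midCoord u v p s u = (1 - (s : ℝ)) * p.1 u + s / 2 := by
  rw [midCoord, Ind.vertex_self, Ind.vertex_of_ne he.ne]
  ring

lemma midCoord_right (he : G.Adj u v) (p : G.Ind) (s : unitInterval) :
    midCoord u v p s v = (1 - (s : ℝ)) * p.1 v + s / 2 := by
  rw [midCoord, Ind.vertex_self, Ind.vertex_of_ne he.ne']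
  ring

lemma midCoord_of_ne (p : G.Ind) (s : unitInterval) {w : V} (hu : w ≠ u) (hv : w ≠ v) :
    midCoord u v p s w = (1 - (s : ℝ)) * p.1 w := by
  rw [midCoord, Ind.vertex_of_ne hu, Ind.vertex_of_ne hv]
  ring

variable [Fintype V]

/-- The inclusion of `Ind(G)` into `Ind(G - e)`. -/
noncomputable def deleteInclusion (G : SimpleGraph V) (u v : V) (p : G.Ind) :
    (G.deleteEdges {s(u, v)}).Ind :=
  Ind.mk p.1 p.nonneg p.sum_eq_one
    (fun _ _ ha hb h => p.not_adj ha hb (deleteEdges_adj.1 h).1)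

/-- The point dividing the segment from a point of `Ind(e ⊔ (G ∖ N[e]))` to the midpoint
of `e` in the ratio `s : 1 - s`. -/
noncomputable def midPoint (he : G.Adj u v)
    (p : Suspension (G.induce (G.edgeNbhd u v)ᶜ).Ind × unitInterval) :
    (G.deleteEdges {s(u, v)}).Ind :=
  Ind.mk (midCoord u v (suspMap he p.1) p.2)
    (fun w => add_nonneg (mul_nonneg (by linarith [p.2.2.2]) (Ind.nonneg _ w))
      (mul_nonneg p.2.2.1 (add_nonneg (div_nonneg (Ind.nonneg _ w) zero_le_two)
        (div_nonneg (Ind.nonneg _ w) zero_le_two))))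
    (by
      simp only [midCoord, Finset.sum_add_distrib, ← Finset.mul_sum, ← Finset.sum_div,
        Ind.sum_eq_one]
      ring)
    (by
      have key : ∀ w, midCoord u v (suspMap he p.1) p.2 w ≠ 0 →
          (w = u ∨ w = v ∨ w ∉ G.edgeNbhd u v) ∧
          (w ∉ G.edgeNbhd u v → (suspMap he p.1).1 w ≠ 0) := fun w hw => by
        by_cases hu : w = u
        · exact ⟨Or.inl hu, fun h => absurd (hu ▸ left_mem_edgeNbhd G u v) h⟩
        by_cases hv : w = v
        · exact ⟨Or.inr (Or.inl hv), fun h => absurd (hv ▸ right_mem_edgeNbhd G u v) h⟩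
        rw [midCoord_of_ne _ _ hu hv] at hw
        have hw := right_ne_zero_of_mul hw
        exact ⟨suspMap_ne_zero he _ w hw, fun _ => hw⟩
      exact fun a b ha hb => not_deleteEdges_pair_adj (key a ha).1 (key b hb).1
        fun ha' hb' => (suspMap he p.1).not_adj ((key a ha).2 ha') ((key b hb).2 hb'))

/-- The comparison map from the mapping cone of the inclusion of `Ind(e ⊔ (G ∖ N[e]))` to
`Ind(G - e)`. -/
noncomputable def coneMap (he : G.Adj u v) :
    MappingCone (suspMap he) → (G.deleteEdges {s(u, v)}).Ind :=
  MappingCone.lift (deleteInclusion G u v) (midPoint he)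
    -- At s = 1 every point gives the midpoint of e; the pole is a choice available even when Ind(G
    -- ∖ N[e]) is empty.
    (midPoint he (Suspension.pole _, 1))
    (fun z => Subtype.ext (funext fun w => by simp [midPoint, deleteInclusion, Ind.mk, midCoord]))
    (fun z => Subtype.ext (funext fun w => by simp [midPoint, Ind.mk, midCoord]))

lemma coneMap_cyl (he : G.Adj u v) (z : Suspension (G.induce (G.edgeNbhd u v)ᶜ).Ind)
    (s : unitInterval) (w : V) :
    (coneMap he (MappingCone.cyl _ (z, s))).1 w = midCoord u v (suspMap he z) s w := rfl

lemma continuous_coneMap (he : G.Adj u v) : Continuous (coneMap he) := by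
  refine MappingCone.continuous_lift ?_ ?_
  · exact Continuous.subtype_mk continuous_subtype_val _
  · refine Continuous.subtype_mk (continuous_pi fun w => ?_) _
    have h : Continuous fun p : Suspension (G.induce (G.edgeNbhd u v)ᶜ).Ind × unitInterval =>
        (suspMap he p.1).1 w :=
      (Ind.continuous_coord w).comp ((suspMap he).continuous.comp continuous_fst)
    have h' : Continuous fun p : Suspension (G.induce (G.edgeNbhd u v)ᶜ).Ind × unitInterval =>
        (p.2 : ℝ) := continuous_subtype_val.comp continuous_snd
    exact ((continuous_const.sub h').mul h).add (h'.mul continuous_const)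

lemma exists_inl_or_cyl (he : G.Adj u v) (c : MappingCone (suspMap he)) :
    (∃ x, c = MappingCone.inl _ x) ∨ ∃ z s, c = MappingCone.cyl _ (z, s) := by
  induction c using MappingCone.ind with
  | hX x => exact Or.inl ⟨x, rfl⟩
  | hc q => exact Or.inr ⟨q.1, q.2, rfl⟩
  | ha => exact Or.inr ⟨Suspension.pole _, 1, (MappingCone.cyl_one _).symm⟩

/-- For s > 0 the u- and v-coordinates are both at least s/2, which is impossible in Ind(G); hence s
= 0. -/
lemma inl_eq_cyl_of_coneMap_eq (he : G.Adj u v) {x : G.Ind}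
    {z : Suspension (G.induce (G.edgeNbhd u v)ᶜ).Ind} {s : unitInterval}
    (h : coneMap he (MappingCone.inl _ x) = coneMap he (MappingCone.cyl _ (z, s))) :
    MappingCone.inl (suspMap he) x = MappingCone.cyl _ (z, s) := by
  have hw : ∀ w, x.1 w = midCoord u v (suspMap he z) s w := fun w => congrArg (fun p => p.1 w) h
  have hu := (hw u).trans (midCoord_left he _ s)
  have hv := (hw v).trans (midCoord_right he _ s)
  have hs0 := s.2.1
  have hu0 := mul_nonneg (sub_nonneg.2 s.2.2) ((suspMap he z).nonneg u)
  have hv0 := mul_nonneg (sub_nonneg.2 s.2.2) ((suspMap he z).nonneg v)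
  obtain rfl : s = 0 := by
    refine Subtype.ext (le_antisymm (not_lt.1 fun hs => ?_) hs0)
    have hs' : (0 : ℝ) < s := hs
    exact x.not_adj (by linarith : 0 < x.1 u).ne' (by linarith : 0 < x.1 v).ne' he
  rw [MappingCone.cyl_zero]
  congr 1
  exact Subtype.ext (funext fun w => (hw w).trans (by simp [midCoord]))

lemma coneMap_injective (he : G.Adj u v) : Function.Injective (coneMap he) := by
  intro c c' h
  rcases exists_inl_or_cyl he c with ⟨x, rfl⟩ | ⟨z, s, rfl⟩ <;>
    rcases exists_inl_or_cyl he c' with ⟨x', rfl⟩ | ⟨z', s', rfl⟩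
  · exact congrArg _ (Subtype.ext (congrArg (fun p => p.1) h))
  · exact inl_eq_cyl_of_coneMap_eq he h
  · exact (inl_eq_cyl_of_coneMap_eq he h.symm).symm
  · have hw : ∀ w, midCoord u v (suspMap he z) s w = midCoord u v (suspMap he z') s' w :=
      fun w => congrArg (fun p => p.1 w) h
    -- The height s is read off the image, because one of the u- and v-coordinates of a point of the
    -- suspension is zero.
    have key : ∀ (z : Suspension (G.induce (G.edgeNbhd u v)ᶜ).Ind) (s : unitInterval), (s : ℝ) / 2 =
        min (midCoord u v (suspMap he z) s u) (midCoord u v (suspMap he z) s v) := fun z s => by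
      rw [midCoord_left he, midCoord_right he]
      have hu0 := mul_nonneg (sub_nonneg.2 s.2.2) ((suspMap he z).nonneg u)
      have hv0 := mul_nonneg (sub_nonneg.2 s.2.2) ((suspMap he z).nonneg v)
      rcases eq_or_ne ((suspMap he z).1 u) 0 with h0 | h0
      · rw [h0, mul_zero, zero_add, min_eq_left (by linarith)]
      · have h0 : (suspMap he z).1 v = 0 := by
          by_contra h1
          exact (suspMap he z).not_adj h0 h1 he
        rw [h0, mul_zero, zero_add, min_eq_right (by linarith)]
    obtain rfl : s = s' := Subtype.ext (by
      have h1 := key z s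
      rw [hw u, hw v, ← key z' s'] at h1
      linarith)
    rcases eq_or_ne s 1 with rfl | hs
    · rw [MappingCone.cyl_one, MappingCone.cyl_one]
    · have hs : 1 - (s : ℝ) ≠ 0 := fun h => hs (Subtype.ext (by simpa using (sub_eq_zero.1 h).symm))
      have hz : suspMap he z = suspMap he z' := Subtype.ext (funext fun w =>
        mul_left_cancel₀ hs (add_right_cancel (hw w)))
      rw [suspMap_injective he hz]

/-- A point with a vanishing u- or v-coordinate already lies in Ind(G). Otherwise the largest
possible multiple s of the midpoint of e is subtracted; the remainder loses u or v, and rescaled it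
lies in the suspension. -/
lemma coneMap_surjective (he : G.Adj u v) : Function.Surjective (coneMap he) := by
  intro q
  have hu0 := q.nonneg u
  have hv0 := q.nonneg v
  by_cases huv : q.1 u = 0 ∨ q.1 v = 0
  · refine ⟨MappingCone.inl _ (Ind.mk q.1 q.nonneg q.sum_eq_one fun a b ha hb h => ?_), rfl⟩
    refine q.not_adj ha hb (deleteEdges_pair_adj_of_ne h ?_ ?_)
    · rintro ⟨rfl, rfl⟩
      exact huv.elim ha hb
    · rintro ⟨rfl, rfl⟩
      exact huv.elim hb ha
  push Not at huv
  -- Only e was deleted, so any other neighbour of u or v is still excluded from a support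
  -- containing both.
  have hsupp : ∀ w, q.1 w ≠ 0 → w = u ∨ w = v ∨ w ∉ G.edgeNbhd u v := fun w hw => by
    by_contra! h
    obtain ⟨hwu, hwv, (h | h) | (h | h)⟩ := h
    · exact hwu h
    · exact q.not_adj huv.1 hw
        (deleteEdges_pair_adj_of_ne h (fun h => hwv h.2) (fun h => hwu h.2))
    · exact hwv h
    · exact q.not_adj huv.2 hw
        (deleteEdges_pair_adj_of_ne h (fun h => hwv h.2) (fun h => hwu h.2))
  have hle : q.1 u + q.1 v ≤ 1 := by
    classical
    rw [← Finset.sum_pair (f := q.1) he.ne]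
    refine le_of_le_of_eq ?_ q.sum_eq_one
    exact Finset.sum_le_sum_of_subset_of_nonneg (Finset.subset_univ _) fun w _ _ => q.nonneg w
  let s : unitInterval := ⟨2 * min (q.1 u) (q.1 v), by positivity, by
    linarith [min_le_left (q.1 u) (q.1 v), min_le_right (q.1 u) (q.1 v)]⟩
  have hs : (s : ℝ) = 2 * min (q.1 u) (q.1 v) := rfl
  have hsu : (s : ℝ) / 2 ≤ q.1 u := by linarith [min_le_left (q.1 u) (q.1 v)]
  have hsv : (s : ℝ) / 2 ≤ q.1 v := by linarith [min_le_right (q.1 u) (q.1 v)]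
  let m : V → ℝ := fun w => (G.indComplex.vertex u).1 w / 2 + (G.indComplex.vertex v).1 w / 2
  have hmu : m u = 1 / 2 := by simp [m, Ind.vertex_self, Ind.vertex_of_ne he.ne]
  have hmv : m v = 1 / 2 := by simp [m, Ind.vertex_self, Ind.vertex_of_ne he.ne']
  have hm0 : ∀ w, w ≠ u → w ≠ v → m w = 0 := fun w hu hv => by
    simp [m, Ind.vertex_of_ne hu, Ind.vertex_of_ne hv]
  have hm1 : ∑ w, m w = 1 := by
    simp only [m, Finset.sum_add_distrib, ← Finset.sum_div, Ind.sum_eq_one]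
    norm_num
  have hd : ∀ w, 0 ≤ q.1 w - s * m w := fun w => by
    by_cases hwu : w = u
    · rw [hwu, hmu]; linarith
    by_cases hwv : w = v
    · rw [hwv, hmv]; linarith
    rw [hm0 w hwu hwv]
    linarith [q.nonneg w]
  have hd1 : ∑ w, (q.1 w - s * m w) = 1 - s := by
    rw [Finset.sum_sub_distrib, ← Finset.mul_sum, hm1, q.sum_eq_one, mul_one]
  have hsupp' : ∀ w, q.1 w - s * m w ≠ 0 → w = u ∨ w = v ∨ w ∉ G.edgeNbhd u v := fun w hw => by
    by_contra! h
    refine hw ?_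
    rw [hm0 w h.1 h.2.1, mul_zero, sub_zero]
    by_contra hne
    rcases hsupp w hne with h' | h' | h'
    exacts [h.1 h', h.2.1 h', h' h.2.2]
  -- If s = 1 nothing remains: the point is the apex, and rescaling by 1 - s must be avoided.
  rcases s.2.2.eq_or_lt with h1 | h1
  · refine ⟨MappingCone.cyl _ (Suspension.pole _, s), Subtype.ext (funext fun w => ?_)⟩
    have hw : q.1 w - s * m w = 0 :=
      congrFun ((Fintype.sum_eq_zero_iff_of_nonneg hd).1 (by rw [hd1, h1, sub_self])) w
    rw [coneMap_cyl, midCoord]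
    simp only [h1] at hw ⊢
    change (1 - 1) * _ + 1 * m w = q.1 w
    linarith
  · have hs1 : 0 < 1 - (s : ℝ) := sub_pos.2 h1
    have hne : ∀ w, (q.1 w - s * m w) / (1 - s) ≠ 0 → q.1 w - s * m w ≠ 0 := fun w hw h =>
      hw (by rw [h, zero_div])
    have hq0 : ∀ w, q.1 w - s * m w ≠ 0 → q.1 w ≠ 0 := fun w hw h => by
      rcases hsupp' w hw with rfl | rfl | h'
      · exact huv.1 h
      · exact huv.2 h
      · exact hw (by rw [h, hm0 w (by rintro rfl; exact h' (left_mem_edgeNbhd G _ _))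
          (by rintro rfl; exact h' (right_mem_edgeNbhd G _ _)), mul_zero, sub_zero])
    have hmin : ¬ (q.1 u - s * m u ≠ 0 ∧ q.1 v - s * m v ≠ 0) := by
      rw [hmu, hmv, hs]
      rcases le_total (q.1 u) (q.1 v) with h | h
      · exact fun h' => h'.1 (by rw [min_eq_left h]; ring)
      · exact fun h' => h'.2 (by rw [min_eq_right h]; ring)
    let p : G.Ind := Ind.mk (fun w => (q.1 w - s * m w) / (1 - s))
      (fun w => div_nonneg (hd w) hs1.le)
      (by rw [← Finset.sum_div, hd1, div_self hs1.ne'])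
      (fun a b ha hb h => by
        have ha := hne a ha
        have hb := hne b hb
        refine q.not_adj (hq0 a ha) (hq0 b hb) (deleteEdges_pair_adj_of_ne h ?_ ?_)
        · rintro ⟨rfl, rfl⟩
          exact hmin ⟨ha, hb⟩
        · rintro ⟨rfl, rfl⟩
          exact hmin ⟨hb, ha⟩)
    obtain ⟨z, hz⟩ := exists_suspMap_eq he p fun w hw => hsupp' w (hne w hw)
    refine ⟨MappingCone.cyl _ (z, s), Subtype.ext (funext fun w => ?_)⟩
    rw [coneMap_cyl, hz]
    change (1 - (s : ℝ)) * ((q.1 w - s * m w) / (1 - s)) + s * m w = q.1 w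
    rw [mul_div_cancel₀ _ hs1.ne']
    ring

/-- `Ind(G - e)` is the mapping cone of the inclusion of `Ind(e ⊔ (G ∖ N[e]))` into `Ind(G)`. -/
noncomputable def coneHomeomorph (he : G.Adj u v) :
    MappingCone (suspMap he) ≃ₜ (G.deleteEdges {s(u, v)}).Ind :=
  Continuous.homeoOfEquivCompactToT2
    (f := Equiv.ofBijective (coneMap he) ⟨coneMap_injective he, coneMap_surjective he⟩)
    (continuous_coneMap he)

end Cone

end SimpleGraph

theorem mainTheorem7 {V : Type*} [Finite V] (G : SimpleGraph V) (u v : V) (he : G.Adj u v)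
    (x y : V) (hx : x ∈ G.edgeNbhd u v) (hy : y ∈ G.edgeNbhd u v)
    (hN : G.closedNbhd x ∪ G.closedNbhd y ⊆ G.edgeNbhd u v)
    (hP : Nonempty (G.induce {x, y, u, v} ≃g SimpleGraph.pathGraph 4)) :
    (G.indInclusion ({u, v} ∪ (G.edgeNbhd u v)ᶜ)).Nullhomotopic ∧
    ∀ a : G.Ind, Joined (G.indComplex.vertex u) a →
      Nonempty (ContinuousMap.HomotopyEquiv (G.deleteEdges {s(u, v)}).Ind
        (Wedge a (Suspension.pole (Suspension (G.induce (G.edgeNbhd u v)ᶜ).Ind)))) := by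
  cases nonempty_fintype V
  obtain ⟨c, d, hvc, hcd, hdu, hc, hd⟩ := SimpleGraph.exists_compl_walk hN hP
  refine ⟨⟨G.indComplex.vertex u, SimpleGraph.homotopic_const_vertex _ he (fun z w hw => ?_)
    hvc hcd hdu hc hd⟩, fun a ⟨γ⟩ => ?_⟩
  · by_contra! h
    refine hw (SimpleGraph.indInclusion_apply_notMem z ?_)
    simp [h.1, h.2.1, h.2.2]
  -- The null-homotopy ends at u; the path γ then slides the constant map to the prescribed base
  -- point.
  · obtain ⟨h⟩ := (SimpleGraph.homotopic_const_vertex (SimpleGraph.suspMap he) he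
      (SimpleGraph.suspMap_ne_zero he) hvc hcd hdu hc hd).trans
      (show (ContinuousMap.const _ (G.indComplex.vertex u)).Homotopic (ContinuousMap.const _ a) from
        ⟨⟨⟨fun p => γ p.1, by fun_prop⟩, fun _ => γ.source, fun _ => γ.target⟩⟩)
    exact ⟨((SimpleGraph.coneHomeomorph he).symm.toHomotopyEquiv.trans
      (MappingCone.homotopyEquiv h)).trans
      (MappingCone.constHomeomorph _ a).toHomotopyEquiv⟩
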